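/- Let $\mathcal H_a=\mathbb C^{d_a}$ with $d_a\ge 2$ and $\mathcal H_b=\mathbb C^{d_b}$, let $\rho$ be a density matrix on $\mathcal H_a\otimes\mathcal H_b$ with marginal $\rho^a=\mathrm{tr}_b\,\rho$, and let $\|O\|=\sqrt{\mathrm{tr}(O^\dagger O)}$. Fix a measurement strength $x\in\mathbb R$ (in particular, any $x>0$) and put $\tau_1=\sqrt{(1-\tanh x)/2}$, $\tau_2=\sqrt{(1+\tanh x)/2}$. A weak measurement $\Omega$ of strength $x$ on $a$ is given by two nonzero orthogonal projectors $\Pi^1,\Pi^2$ on $\mathcal H_a$ with $\Pi^1+\Pi^2=\mathbb 1$, through the operators $$\Omega_x=\tau_1\Pi^1+\tau_2\Pi^2,\qquad \Omega_{-x}=\tau_2\Pi^1+\tau_1\Pi^2 .$$ It acts on operators $X$ of $ab$ by $\Omega(X)=\sum_{k=\pm x}(\Omega_k\otimes\mathbb 1)X(\Omega_k\otimes\mathbb 1)$ and on operators $Y$ of $a$ by $\Omega(Y)=\sum_{k=\pm x}\Omega_kY\Omega_k$. Put $$C_H(\rho|\Omega)=\|\sqrt\rho-\Omega(\sqrt\rho)\|^2,\qquad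 C_H(\rho^a|\Omega)=\|\sqrt{\rho^a}-\Omega(\sqrt{\rho^a})\|^2 ,$$ $$\mathcal Q_w(\rho)=\min_{\Omega}\big[C_H(\rho|\Omega)-C_H(\rho^a|\Omega)\big],$$ where $\Omega$ ranges over all weak measurements of strength $x$ on $a$. Then the minimum is attained, and $\mathcal Q_w(\rho)\ge 0$. Moreover $\mathcal Q_w(\rho)=0$ whenever $\rho$ is classically correlated, that is, whenever $\rho=\Pi^a(\rho):=\sum_k(|k\rangle\langle k|\otimes\mathbb 1)\,\rho\,(|k\rangle\langle k|\otimes\mathbb 1)$ for some orthonormal basis $\{|k\rangle\}$ of $\mathcal H_a$; and, more generally, whenever $\rho=\sum_{k=1,2}(\Pi^k\otimes\mathbb 1)\,\rho\,(\Pi^k\otimes\mathbb 1)$ for some pair of nonzero orthogonal projectors $\Pi^1,\Pi^2$ on $\mathcal H_a$ with $\Pi^1+\Pi^2=\mathbb 1$. -/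

import Mathlib

open scoped Matrix Kronecker MatrixOrder ComplexOrder

noncomputable section

/-- A quantum state on the Hilbert space `ℂ^ι`. -/
def IsDensityMatrix {ι : Type*} [Fintype ι] (ρ : Matrix ι ι ℂ) : Prop :=
  ρ.PosSemidef ∧ ρ.trace = 1

/-- The marginal state `ρ^a = tr_b ρ` of a bipartite state. -/
def marginalA {m n : Type*} [Fintype n] (ρ : Matrix (m × n) (m × n) ℂ) : Matrix m m ℂ :=
  Matrix.of fun i j => ∑ k, ρ (i, k) (j, k)

/-- The Hilbert-Schmidt norm `√(tr (O† O))`. -/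
def hsNorm {ι : Type*} [Fintype ι] (O : Matrix ι ι ℂ) : ℝ :=
  Real.sqrt ((Oᴴ * O).trace.re)

/-- A pair of nonzero orthogonal projectors `Π¹`, `Π²` with `Π¹ + Π² = 1`. -/
@[ext]
structure ProjectorPair (m : Type*) [Fintype m] [DecidableEq m] where
  P₁ : Matrix m m ℂ
  P₂ : Matrix m m ℂ
  isStarProjection₁ : IsStarProjection P₁
  isStarProjection₂ : IsStarProjection P₂
  orthogonal : P₁ * P₂ = 0
  sum_eq_one : P₁ + P₂ = 1
  ne_zero₁ : P₁ ≠ 0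
  ne_zero₂ : P₂ ≠ 0

/-- `τ₁ = √((1 - tanh x) / 2)`. -/
def tauOne (x : ℝ) : ℝ := Real.sqrt ((1 - Real.tanh x) / 2)

/-- `τ₂ = √((1 + tanh x) / 2)`. -/
def tauTwo (x : ℝ) : ℝ := Real.sqrt ((1 + Real.tanh x) / 2)

namespace ProjectorPair

variable {m : Type*} [Fintype m] [DecidableEq m]

/-- The weak measurement operator `Ω_x = τ₁ Π¹ + τ₂ Π²`. -/
def weakPos (P : ProjectorPair m) (x : ℝ) : Matrix m m ℂ :=
  (tauOne x : ℂ) • P.P₁ + (tauTwo x : ℂ) • P.P₂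

/-- The weak measurement operator `Ω_{-x} = τ₂ Π¹ + τ₁ Π²`. -/
def weakNeg (P : ProjectorPair m) (x : ℝ) : Matrix m m ℂ :=
  (tauTwo x : ℂ) • P.P₁ + (tauOne x : ℂ) • P.P₂

/-- The weak measurement map on operators of the system `a` alone. -/
def weakMap (P : ProjectorPair m) (x : ℝ) (X : Matrix m m ℂ) : Matrix m m ℂ :=
  P.weakPos x * X * P.weakPos x + P.weakNeg x * X * P.weakNeg x

/-- The weak measurement map on operators of the system `ab`, measuring the subsystem `a`. -/
def weakMapAB {n : Type*} [Fintype n] [DecidableEq n] (P : ProjectorPair m) (x : ℝ)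
    (X : Matrix (m × n) (m × n) ℂ) : Matrix (m × n) (m × n) ℂ :=
  (P.weakPos x ⊗ₖ (1 : Matrix n n ℂ)) * X * (P.weakPos x ⊗ₖ (1 : Matrix n n ℂ)) +
    (P.weakNeg x ⊗ₖ (1 : Matrix n n ℂ)) * X * (P.weakNeg x ⊗ₖ (1 : Matrix n n ℂ))

/-- The projective measurement `X ↦ ∑ₖ (Πᵏ ⊗ 1) X (Πᵏ ⊗ 1)` for the two projectors. -/
def projMapAB {n : Type*} [Fintype n] [DecidableEq n] (P : ProjectorPair m)
    (X : Matrix (m × n) (m × n) ℂ) : Matrix (m × n) (m × n) ℂ :=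
  (P.P₁ ⊗ₖ (1 : Matrix n n ℂ)) * X * (P.P₁ ⊗ₖ (1 : Matrix n n ℂ)) +
    (P.P₂ ⊗ₖ (1 : Matrix n n ℂ)) * X * (P.P₂ ⊗ₖ (1 : Matrix n n ℂ))

/-- `C_H(σ|Ω) = ‖√σ - Ω(√σ)‖²` for a state `σ` of the system `a`. -/
def coherence (P : ProjectorPair m) (x : ℝ) (σ : Matrix m m ℂ) : ℝ :=
  hsNorm (CFC.sqrt σ - P.weakMap x (CFC.sqrt σ)) ^ 2

/-- `C_H(ρ|Ω) = ‖√ρ - Ω(√ρ)‖²` for a state `ρ` of the system `ab`. -/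
def coherenceAB {n : Type*} [Fintype n] [DecidableEq n] (P : ProjectorPair m) (x : ℝ)
    (ρ : Matrix (m × n) (m × n) ℂ) : ℝ :=
  hsNorm (CFC.sqrt ρ - P.weakMapAB x (CFC.sqrt ρ)) ^ 2

/-- `Δ_w(ρ|Ω) = C_H(ρ|Ω) - C_H(ρ^a|Ω)`. -/
def deltaW {n : Type*} [Fintype n] [DecidableEq n] (P : ProjectorPair m) (x : ℝ)
    (ρ : Matrix (m × n) (m × n) ℂ) : ℝ :=
  P.coherenceAB x ρ - P.coherence x (marginalA ρ)

end ProjectorPair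

/-- `Q_w(ρ) = min_Ω Δ_w(ρ|Ω)`, over all weak measurements of the fixed strength `x` on `a`. -/
def weakCorrelation {m n : Type*} [Fintype m] [DecidableEq m] [Fintype n] [DecidableEq n]
    (x : ℝ) (ρ : Matrix (m × n) (m × n) ℂ) : ℝ :=
  ⨅ P : ProjectorPair m, P.deltaW x ρ

/-- The rank-one projector `|v⟩⟨v|`. -/
def ketBra {m : Type*} (v : EuclideanSpace ℂ m) : Matrix m m ℂ :=
  Matrix.vecMulVec (fun i => v i) (fun j => star (v j))

/-- The von Neumann measurement `Π^a(X) = ∑ₖ (|k⟩⟨k| ⊗ 1) X (|k⟩⟨k| ⊗ 1)` of the subsystem `a`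
in the orthonormal basis `e`. -/
def vonNeumannMapAB {m n : Type*} [Fintype m] [DecidableEq m] [Fintype n] [DecidableEq n]
    (e : OrthonormalBasis m ℂ (EuclideanSpace ℂ m)) (X : Matrix (m × n) (m × n) ℂ) :
    Matrix (m × n) (m × n) ℂ :=
  ∑ k, (ketBra (e k) ⊗ₖ (1 : Matrix n n ℂ)) * X * (ketBra (e k) ⊗ₖ (1 : Matrix n n ℂ))

/-- A state is classically correlated if it is invariant under some von Neumann measurement of
the subsystem `a`. -/
def IsClassicallyCorrelated {m n : Type*} [Fintype m] [DecidableEq m] [Fintype n] [DecidableEq n]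
    (ρ : Matrix (m × n) (m × n) ℂ) : Prop :=
  ∃ e : OrthonormalBasis m ℂ (EuclideanSpace ℂ m), vonNeumannMapAB e ρ = ρ

end

/-! Put `p = Π¹`, `q = Π²`. A weak measurement keeps the diagonal blocks of `X` and scales the
off-diagonal ones by `2τ₁τ₂`, so `X - Ω(X) = (1 - 2τ₁τ₂)(pXq + qXp)`. Hence `C_H(σ|Ω)` is a
nonnegative constant times the skew information `tr(σp) - tr(√σ p √σ p)` (`hsNorm_sub_weak_sq`). In
`Δ_w` the terms linear in `p` cancel, and nonnegativity becomes `tr(√ρ (p⊗1) √ρ (p⊗1)) ≤ tr(√ρᵃ p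
√ρᵃ p)`.

This is proved for every `K` in place of `p` (`re_trace_sandwich_kronecker_le`). By Cauchy-Schwarz,
the hermitian form `tr(√ρ (K⊗1)† √ρ (L⊗1))` is dominated by `tr(ρᵃK†K)` and `tr(ρᵃLL†)`. In an
eigenbasis of `√ρᵃ` both are diagonal, and their geometric mean, which bounds the form, is `tr(√ρᵃ
K† √ρᵃ K)`.

The minimum exists because `Δ_w` is continuous in `p` and the admissible `p` form a compact set. If
`ρ` is block diagonal for `p`, then `√ρ` commutes with `p⊗1` and `C_H(ρ|Ω) = 0`, which forces `Δ_w =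
0`. -/

/-! ### Cauchy-Schwarz and geometric means of diagonal forms -/

theorem norm_sq_trace_conjTranspose_mul_le {ι κ : Type*} [Fintype ι] [Fintype κ]
    (A B : Matrix ι κ ℂ) :
    ‖(Aᴴ * B).trace‖ ^ 2 ≤ (Aᴴ * A).trace.re * (Bᴴ * B).trace.re := by
  have hsq : ∀ C : Matrix ι κ ℂ, (Cᴴ * C).trace.re = ∑ p : κ × ι, ‖C p.2 p.1‖ ^ 2 := by
    intro C
    simp only [Matrix.trace, Matrix.diag, Matrix.mul_apply, Matrix.conjTranspose_apply,
      Complex.re_sum, Fintype.sum_prod_type]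
    refine Finset.sum_congr rfl fun i _ => Finset.sum_congr rfl fun j _ => ?_
    rw [Complex.star_def, Complex.conj_mul', ← Complex.ofReal_pow, Complex.ofReal_re]
  have hle : ‖(Aᴴ * B).trace‖ ≤ ∑ p : κ × ι, ‖A p.2 p.1‖ * ‖B p.2 p.1‖ := by
    simp only [Matrix.trace, Matrix.diag, Matrix.mul_apply, Matrix.conjTranspose_apply]
    rw [← Fintype.sum_prod_type']
    refine (norm_sum_le _ _).trans (Finset.sum_le_sum fun p _ => ?_)
    rw [norm_mul, norm_star]
  rw [hsq, hsq]
  exact (pow_le_pow_left₀ (norm_nonneg _) hle 2).trans (Finset.sum_mul_sq_le_sq_mul_sq _ _ _)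

theorem re_star_dotProduct_self {ι : Type*} [Fintype ι] (u : ι → ℂ) :
    (star u ⬝ᵥ u).re = ∑ i, ‖u i‖ ^ 2 := by
  simp only [dotProduct, Complex.re_sum, Pi.star_apply]
  refine Finset.sum_congr rfl fun i _ => ?_
  rw [Complex.star_def, Complex.conj_mul', ← Complex.ofReal_pow, Complex.ofReal_re]

/-- If `Y² ≤ C²` for a nonnegative diagonal matrix `C`, then `Y ≤ C`. -/
theorem re_star_dotProduct_mulVec_le_of_sq_le {ι : Type*} [Fintype ι] [DecidableEq ι]
    {Y : Matrix ι ι ℂ} (hY : Y.IsHermitian) {c : ι → ℝ} (hc : ∀ i, 0 < c i)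
    (h : ∀ u, ∑ i, ‖(Y *ᵥ u) i‖ ^ 2 ≤ ∑ i, (c i * ‖u i‖) ^ 2) (u : ι → ℂ) :
    (star u ⬝ᵥ Y *ᵥ u).re ≤ ∑ i, c i * ‖u i‖ ^ 2 := by
  have hC : (Matrix.diagonal fun i => (c i : ℂ)).IsHermitian := by
    rw [Matrix.IsHermitian, Matrix.diagonal_conjTranspose]
    congr 1; ext i; simp
  have hZ := hC.sub hY
  have hpos : ((Matrix.diagonal fun i => (c i : ℂ)) - Y).PosSemidef := by
    rw [hZ.posSemidef_iff_eigenvalues_nonneg]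
    intro j
    -- For an eigenvector `v` of `C - Y` with eigenvalue `μ < 0`, `(Yv)ᵢ = (cᵢ - μ)vᵢ`, so `Yv` is
    -- strictly longer than `Cv`.
    by_contra hj
    simp only [Pi.zero_apply, not_le] at hj
    set μ := hZ.eigenvalues j
    set v : ι → ℂ := ⇑(hZ.eigenvectorBasis j)
    have hv : ((Matrix.diagonal fun i => (c i : ℂ)) - Y) *ᵥ v = μ • v :=
      hZ.mulVec_eigenvectorBasis j
    have hv0 : ∃ i, v i ≠ 0 := by
      by_contra! hcon
      apply hZ.eigenvectorBasis.orthonormal.ne_zero j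
      ext i
      exact hcon i
    have hYv : ∀ i, (Y *ᵥ v) i = ((c i - μ : ℝ) : ℂ) * v i := by
      intro i
      have := congrFun hv i
      simp only [Matrix.sub_mulVec, Pi.sub_apply, Matrix.mulVec_diagonal, Pi.smul_apply,
        Complex.real_smul] at this
      push_cast
      linear_combination -this
    have hlt : ∑ i, (c i * ‖v i‖) ^ 2 < ∑ i, ‖(Y *ᵥ v) i‖ ^ 2 := by
      have hle : ∀ i, c i * ‖v i‖ ≤ ‖(Y *ᵥ v) i‖ := fun i => by
        rw [hYv, norm_mul, Complex.norm_real, Real.norm_eq_abs]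
        have := le_abs_self (c i - μ)
        gcongr
        linarith
      obtain ⟨i, hi⟩ := hv0
      refine Finset.sum_lt_sum (fun i _ => ?_) ⟨i, Finset.mem_univ _, ?_⟩
      · exact pow_le_pow_left₀ (mul_nonneg (hc i).le (norm_nonneg _)) (hle i) 2
      · refine pow_lt_pow_left₀ ?_ (mul_nonneg (hc i).le (norm_nonneg _)) two_ne_zero
        rw [hYv, norm_mul, Complex.norm_real, Real.norm_eq_abs]
        have := le_abs_self (c i - μ)
        have := norm_pos_iff.mpr hi
        gcongr
        linarith
    exact absurd (h v) (not_le.mpr hlt)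
  have h0 := hpos.re_dotProduct_nonneg u
  rw [Matrix.sub_mulVec, dotProduct_sub, map_sub, sub_nonneg] at h0
  refine (show _ ≤ _ from h0).trans_eq ?_
  simp only [dotProduct, Matrix.mulVec_diagonal, Pi.star_apply, map_sum]
  refine Finset.sum_congr rfl fun i _ => ?_
  rw [mul_left_comm, Complex.star_def, Complex.conj_mul']
  simp only [RCLike.re_to_complex]
  norm_cast

/-- A hermitian form dominated by two positive diagonal forms is at most their geometric mean. -/
theorem re_star_dotProduct_mulVec_le_of_pos {ι : Type*} [Fintype ι] [DecidableEq ι]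
    {X : Matrix ι ι ℂ} (hX : X.IsHermitian) {a b : ι → ℝ} (ha : ∀ i, 0 < a i)
    (hb : ∀ i, 0 < b i)
    (h : ∀ u v, ‖star u ⬝ᵥ X *ᵥ v‖ ^ 2 ≤
      (∑ i, (a i * ‖u i‖) ^ 2) * ∑ i, (b i * ‖v i‖) ^ 2) (u : ι → ℂ) :
    (star u ⬝ᵥ X *ᵥ u).re ≤ ∑ i, a i * b i * ‖u i‖ ^ 2 := by
  -- Conjugation by `D = B⁻¹` turns the second form into the identity.
  set D : Matrix ι ι ℂ := Matrix.diagonal fun i => ((b i)⁻¹ : ℂ) with hD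
  have hDH : Dᴴ = D := by
    rw [hD, Matrix.diagonal_conjTranspose]
    congr 1; ext i; simp
  have hDform : ∀ u v, star u ⬝ᵥ (D * X * D) *ᵥ v = star (D *ᵥ u) ⬝ᵥ X *ᵥ (D *ᵥ v) := by
    intro u v
    rw [Matrix.star_mulVec, hDH, ← Matrix.dotProduct_mulVec, Matrix.mulVec_mulVec,
      Matrix.mulVec_mulVec, Matrix.mul_assoc]
  have hDn : ∀ u i, ‖(D *ᵥ u) i‖ = (b i)⁻¹ * ‖u i‖ := by
    intro u i
    rw [hD, Matrix.mulVec_diagonal, norm_mul, norm_inv, Complex.norm_real, Real.norm_eq_abs,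
      abs_of_pos (hb i)]
  have hY : (D * X * D).IsHermitian := by
    rw [Matrix.IsHermitian, Matrix.conjTranspose_mul, Matrix.conjTranspose_mul, hDH, hX.eq,
      Matrix.mul_assoc]
  have hYsq : ∀ w, ∑ i, ‖((D * X * D) *ᵥ w) i‖ ^ 2 ≤ ∑ i, (a i / b i * ‖w i‖) ^ 2 := by
    intro w
    set z := (D * X * D) *ᵥ w
    -- With `z = DXDw` as second argument, the hypothesis reads `‖z‖⁴ ≤ ‖AB⁻¹w‖² ‖z‖²`; cancelling
    -- `‖z‖²` gives `(DXD)² ≤ (AB⁻¹)²`.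
    have h1 := h (D *ᵥ w) (D *ᵥ z)
    rw [← hDform, Matrix.dotProduct_mulVec, ← hY.eq, ← Matrix.star_mulVec] at h1
    have h2 : (∑ i, ‖z i‖ ^ 2) ^ 2 ≤ ‖star z ⬝ᵥ z‖ ^ 2 := by
      rw [← re_star_dotProduct_self, sq_le_sq, abs_norm]
      exact Complex.abs_re_le_norm _
    have h3 : ∑ i, (b i * ‖(D *ᵥ z) i‖) ^ 2 = ∑ i, ‖z i‖ ^ 2 :=
      Finset.sum_congr rfl fun i _ => by rw [hDn, mul_inv_cancel_left₀ (hb i).ne']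
    have h4 : ∑ i, (a i * ‖(D *ᵥ w) i‖) ^ 2 = ∑ i, (a i / b i * ‖w i‖) ^ 2 :=
      Finset.sum_congr rfl fun i _ => by rw [hDn, div_eq_mul_inv, mul_assoc]
    rw [h3, h4] at h1
    have h5 := h2.trans h1
    rcases (Finset.sum_nonneg fun i _ => sq_nonneg ‖z i‖ :
      0 ≤ ∑ i, ‖z i‖ ^ 2).eq_or_lt with h0 | h0
    · rw [← h0]
      positivity
    · rw [sq] at h5
      exact le_of_mul_le_mul_right h5 h0
  have key := re_star_dotProduct_mulVec_le_of_sq_le hY (fun i => div_pos (ha i) (hb i)) hYsq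
    (fun i => (b i : ℂ) * u i)
  have hu : D *ᵥ (fun i => (b i : ℂ) * u i) = u := by
    ext i
    rw [hD, Matrix.mulVec_diagonal, inv_mul_cancel_left₀]
    exact_mod_cast (hb i).ne'
  rw [hDform, hu] at key
  refine key.trans_eq (Finset.sum_congr rfl fun i _ => ?_)
  rw [norm_mul, Complex.norm_real, Real.norm_eq_abs, abs_of_pos (hb i)]
  have := (hb i).ne'
  field_simp

/-- A hermitian form dominated by two nonnegative diagonal forms is at most their geometric mean. -/
theorem re_star_dotProduct_mulVec_le {ι : Type*} [Fintype ι] [DecidableEq ι]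
    {X : Matrix ι ι ℂ} (hX : X.IsHermitian) {a b : ι → ℝ} (ha : ∀ i, 0 ≤ a i)
    (hb : ∀ i, 0 ≤ b i)
    (h : ∀ u v, ‖star u ⬝ᵥ X *ᵥ v‖ ^ 2 ≤
      (∑ i, (a i * ‖u i‖) ^ 2) * ∑ i, (b i * ‖v i‖) ^ 2) (u : ι → ℂ) :
    (star u ⬝ᵥ X *ᵥ u).re ≤ ∑ i, a i * b i * ‖u i‖ ^ 2 := by
  -- Replacing `a, b` by `a + ε, b + ε` only enlarges the dominating forms, so the positive case
  -- applies, and `ε → 0`.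
  have hlim : Filter.Tendsto (fun ε : ℝ => ∑ i, (a i + ε) * (b i + ε) * ‖u i‖ ^ 2)
      (nhdsWithin 0 (Set.Ioi 0)) (nhds (∑ i, a i * b i * ‖u i‖ ^ 2)) := by
    have hcont : Continuous fun ε : ℝ => ∑ i, (a i + ε) * (b i + ε) * ‖u i‖ ^ 2 := by fun_prop
    have := hcont.tendsto 0
    simp only [add_zero] at this
    exact this.mono_left nhdsWithin_le_nhds
  refine ge_of_tendsto hlim ?_
  filter_upwards [self_mem_nhdsWithin] with ε (hε : 0 < ε)
  refine re_star_dotProduct_mulVec_le_of_pos hX (fun i => by linarith [ha i])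
    (fun i => by linarith [hb i]) (fun u v => (h u v).trans ?_) u
  have hmono : ∀ (d : ι → ℝ), (∀ i, 0 ≤ d i) → ∀ w : ι → ℂ,
      ∑ i, (d i * ‖w i‖) ^ 2 ≤ ∑ i, ((d i + ε) * ‖w i‖) ^ 2 := fun d hd w =>
    Finset.sum_le_sum fun i _ => pow_le_pow_left₀ (mul_nonneg (hd i) (norm_nonneg _))
      (by gcongr; linarith) 2
  exact mul_le_mul (hmono a ha u) (hmono b hb v) (by positivity) (by positivity)

/-! ### Partial trace and monotonicity of the trace form -/

theorem posSemidef_marginalA {m n : Type*} [Fintype m] [Fintype n]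
    {ρ : Matrix (m × n) (m × n) ℂ} (hρ : ρ.PosSemidef) : (marginalA ρ).PosSemidef := by
  have : marginalA ρ = ∑ k : n, ρ.submatrix (fun i => (i, k)) (fun i => (i, k)) := by
    ext i j
    simp [marginalA, Matrix.sum_apply]
  rw [this]
  exact Matrix.posSemidef_sum _ fun k _ => hρ.submatrix _

theorem trace_mul_kronecker_one {m n : Type*} [Fintype m] [Fintype n] [DecidableEq n]
    (ρ : Matrix (m × n) (m × n) ℂ) (M : Matrix m m ℂ) :
    (ρ * (M ⊗ₖ (1 : Matrix n n ℂ))).trace = (marginalA ρ * M).trace := by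
  simp only [Matrix.trace, Matrix.diag, Matrix.mul_apply, marginalA, Matrix.of_apply,
    Matrix.kroneckerMap_apply, Fintype.sum_prod_type, Matrix.one_apply, mul_ite, mul_one,
    mul_zero, Finset.sum_ite_eq', Finset.mem_univ, if_true, Finset.sum_mul]
  exact Finset.sum_congr rfl fun i _ => Finset.sum_comm

theorem trace_diagonal_sandwich {m : Type*} [Fintype m] [DecidableEq m] (s t : m → ℝ)
    (U : Matrix m m ℂ) :
    (Matrix.diagonal (fun i => (s i : ℂ)) * Uᴴ * Matrix.diagonal (fun i => (t i : ℂ)) * U).trace =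
      ((∑ p : m × m, s p.2 * t p.1 * ‖U p.1 p.2‖ ^ 2 : ℝ) : ℂ) := by
  simp only [Matrix.trace, Matrix.diag]
  rw [Fintype.sum_prod_type_right]
  push_cast
  refine Finset.sum_congr rfl fun i _ => ?_
  rw [Matrix.mul_apply]
  refine Finset.sum_congr rfl fun j _ => ?_
  rw [Matrix.mul_diagonal, Matrix.diagonal_mul, Matrix.conjTranspose_apply, Complex.star_def,
    ← Complex.conj_mul']
  ring

/-- A sesquilinear trace form is given by a matrix. -/
theorem exists_isHermitian_trace_form {ι N : Type*} [Fintype ι] [DecidableEq ι] [Fintype N]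
    {G : Matrix N N ℂ} (hG : G.IsHermitian) (T : (ι → ℂ) →ₗ[ℂ] Matrix N N ℂ) :
    ∃ X : Matrix ι ι ℂ, X.IsHermitian ∧
      ∀ u v, star u ⬝ᵥ X *ᵥ v = (G * (T u)ᴴ * G * T v).trace := by
  refine ⟨Matrix.of fun i j =>
    (G * (T (Pi.single i 1))ᴴ * G * T (Pi.single j 1)).trace, ?_, fun u v => ?_⟩
  · ext i j
    rw [Matrix.conjTranspose_apply, Matrix.of_apply, Matrix.of_apply, ← Matrix.trace_conjTranspose]
    simp only [Matrix.conjTranspose_mul, Matrix.conjTranspose_conjTranspose, hG.eq]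
    rw [Matrix.trace_mul_comm]
    simp only [Matrix.mul_assoc]
    rw [Matrix.trace_mul_comm]
    simp only [Matrix.mul_assoc]
    rw [Matrix.trace_mul_comm]
    simp only [Matrix.mul_assoc]
  · have hT : ∀ w, T w = ∑ i, w i • T (Pi.single i 1) := fun w => by
      conv_lhs => rw [pi_eq_sum_univ' w]
      simp only [map_sum, map_smul]
    rw [hT u, hT v]
    simp only [Matrix.conjTranspose_sum, Matrix.conjTranspose_smul, Matrix.sum_mul,
      Matrix.trace_sum, Matrix.mul_smul, Matrix.smul_mul, Matrix.trace_smul, dotProduct,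
      Matrix.mulVec, Matrix.of_apply, Finset.mul_sum, smul_eq_mul, Pi.star_apply]
    rw [Finset.sum_comm]
    exact Finset.sum_congr rfl fun i _ => Finset.sum_congr rfl fun j _ => by ring

/-- Monotonicity of `(K, K) ↦ tr (√ρ K† √ρ K)` under the partial trace. -/
theorem re_trace_sandwich_kronecker_le {m n : Type*} [Fintype m] [DecidableEq m]
    [Fintype n] [DecidableEq n] {ρ G : Matrix (m × n) (m × n) ℂ} (hG : G.IsHermitian)
    (hGρ : G * G = ρ) {S : Matrix m m ℂ} (hS : S.PosSemidef) (hSρ : S * S = marginalA ρ)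
    (K : Matrix m m ℂ) :
    (G * (K ⊗ₖ (1 : Matrix n n ℂ))ᴴ * G * (K ⊗ₖ (1 : Matrix n n ℂ))).trace.re ≤
      (S * Kᴴ * S * K).trace.re := by
  set s := hS.1.eigenvalues
  have hs : ∀ i, 0 ≤ s i := hS.eigenvalues_nonneg
  set W : Matrix m m ℂ := (hS.1.eigenvectorUnitary : Matrix m m ℂ)
  have hWW : Wᴴ * W = 1 := Matrix.mem_unitaryGroup_iff'.mp hS.1.eigenvectorUnitary.2
  have hWW' : W * Wᴴ = 1 := Matrix.mem_unitaryGroup_iff.mp hS.1.eigenvectorUnitary.2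
  set D : Matrix m m ℂ := Matrix.diagonal fun i => (s i : ℂ)
  have hSD : S = W * D * Wᴴ := by
    have := hS.1.spectral_theorem
    rw [Unitary.conjStarAlgAut_apply] at this
    exact this
  have hSS : marginalA ρ = W * (D * D) * Wᴴ := by
    rw [← hSρ, hSD]
    simp only [Matrix.mul_assoc]
    rw [← Matrix.mul_assoc Wᴴ W, hWW, Matrix.one_mul]
  -- `T` takes the entries of an operator in the eigenbasis of `S`; there left and right
  -- multiplication by `ρᵃ` are both diagonal.
  let T : (m × m → ℂ) →ₗ[ℂ] Matrix (m × n) (m × n) ℂ :=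
    { toFun := fun u => (W * Matrix.of (fun i j => u (i, j)) * Wᴴ) ⊗ₖ (1 : Matrix n n ℂ)
      map_add' := fun u v => by
        rw [← Matrix.add_kronecker, ← Matrix.add_mul, ← Matrix.mul_add]; rfl
      map_smul' := fun c u => by
        rw [RingHom.id_apply, ← Matrix.smul_kronecker, ← Matrix.smul_mul, ← Matrix.mul_smul]; rfl }
  obtain ⟨X, hX, hXT⟩ := exists_isHermitian_trace_form hG T
  have hTT : ∀ A B : Matrix m m ℂ, (ρ * ((W * A * Wᴴ) ⊗ₖ (1 : Matrix n n ℂ) *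
      (W * B * Wᴴ) ⊗ₖ (1 : Matrix n n ℂ))).trace = (D * D * A * B).trace := by
    intro A B
    rw [← Matrix.mul_kronecker_mul, Matrix.one_mul, trace_mul_kronecker_one, hSS,
      Matrix.mul_assoc W (D * D), Matrix.mul_assoc W, Matrix.trace_mul_comm]
    simp only [Matrix.mul_assoc, hWW, Matrix.mul_one]
    simp only [← Matrix.mul_assoc Wᴴ W, hWW, Matrix.one_mul]
  have hTH : ∀ u, (T u)ᴴ =
      (W * (Matrix.of (fun i j => u (i, j)))ᴴ * Wᴴ) ⊗ₖ (1 : Matrix n n ℂ) := by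
    intro u
    change ((W * Matrix.of (fun i j => u (i, j)) * Wᴴ) ⊗ₖ (1 : Matrix n n ℂ))ᴴ = _
    rw [Matrix.conjTranspose_kronecker, Matrix.conjTranspose_one, Matrix.conjTranspose_mul,
      Matrix.conjTranspose_mul, Matrix.conjTranspose_conjTranspose, Matrix.mul_assoc]
  have hDD : D * D = Matrix.diagonal fun i => ((s i ^ 2 : ℝ) : ℂ) := by
    rw [Matrix.diagonal_mul_diagonal]
    congr 1; ext i; push_cast; ring
  have hone : (1 : Matrix m m ℂ) = Matrix.diagonal fun _ => ((1 : ℝ) : ℂ) := by simp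
  have hleft : ∀ u, ((T u * G)ᴴ * (T u * G)).trace.re = ∑ p : m × m, (s p.2 * ‖u p‖) ^ 2 := by
    intro u
    rw [Matrix.conjTranspose_mul, hG.eq, ← Matrix.mul_assoc, Matrix.trace_mul_comm,
      Matrix.mul_assoc, ← Matrix.mul_assoc, hGρ, hTH]
    refine (congrArg Complex.re (hTT _ _)).trans ?_
    rw [← Matrix.mul_one (D * D * _), hone, hDD, trace_diagonal_sandwich, Complex.ofReal_re]
    exact Finset.sum_congr rfl fun p _ => by simp [mul_pow]
  have hright : ∀ v, ((G * T v)ᴴ * (G * T v)).trace.re = ∑ p : m × m, (s p.1 * ‖v p‖) ^ 2 := by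
    intro v
    rw [Matrix.conjTranspose_mul, hG.eq, Matrix.mul_assoc, ← Matrix.mul_assoc G G, hGρ,
      Matrix.trace_mul_comm, Matrix.mul_assoc, hTH]
    refine (congrArg Complex.re (hTT _ _)).trans ?_
    rw [Matrix.trace_mul_comm, ← Matrix.mul_assoc, ← Matrix.one_mul (_ᴴ), hone, hDD,
      trace_diagonal_sandwich, Complex.ofReal_re]
    exact Finset.sum_congr rfl fun p _ => by simp [mul_pow]
  have hform : ∀ u v, ‖star u ⬝ᵥ X *ᵥ v‖ ^ 2 ≤
      (∑ p : m × m, (s p.2 * ‖u p‖) ^ 2) * ∑ p : m × m, (s p.1 * ‖v p‖) ^ 2 := by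
    intro u v
    have h := norm_sq_trace_conjTranspose_mul_le (T u * G) (G * T v)
    rw [hleft, hright, Matrix.conjTranspose_mul, hG.eq, ← Matrix.mul_assoc] at h
    rwa [hXT]
  set U : Matrix m m ℂ := Wᴴ * K * W
  have hKU : K = W * U * Wᴴ := by
    simp only [U, ← Matrix.mul_assoc, hWW', Matrix.one_mul]
    rw [Matrix.mul_assoc, hWW', Matrix.mul_one]
  have key := re_star_dotProduct_mulVec_le hX (fun p => hs p.2) (fun p => hs p.1) hform
    (fun p => U p.1 p.2)
  rw [hXT] at key
  have hTK : T (fun p => U p.1 p.2) = K ⊗ₖ (1 : Matrix n n ℂ) := by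
    rw [hKU]; rfl
  rw [hTK] at key
  refine key.trans_eq ?_
  rw [← Complex.ofReal_re (∑ p : m × m, _), ← trace_diagonal_sandwich, hKU, hSD]
  simp only [Matrix.conjTranspose_mul, Matrix.conjTranspose_conjTranspose, Matrix.mul_assoc]
  simp only [← Matrix.mul_assoc Wᴴ W, hWW, Matrix.one_mul]
  rw [Matrix.trace_mul_comm W]
  simp only [Matrix.mul_assoc, hWW, Matrix.mul_one]
  rfl

/-! ### Coherence as skew information -/

theorem tauOne_sq_add_tauTwo_sq (x : ℝ) : tauOne x ^ 2 + tauTwo x ^ 2 = 1 := by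
  have h1 := Real.neg_one_lt_tanh x
  have h2 := Real.tanh_lt_one x
  rw [tauOne, tauTwo, Real.sq_sqrt (by linarith), Real.sq_sqrt (by linarith)]
  ring

theorem hsNorm_sq {ι : Type*} [Fintype ι] (O : Matrix ι ι ℂ) :
    hsNorm O ^ 2 = (Oᴴ * O).trace.re := by
  refine Real.sq_sqrt ?_
  exact (Complex.nonneg_iff.mp (Matrix.posSemidef_conjTranspose_mul_self O).trace_nonneg).1

/-- The disturbance caused by a weak measurement, in terms of the skew information. -/
theorem hsNorm_sub_weak_sq {N : Type*} [Fintype N] [DecidableEq N] {p q X : Matrix N N ℂ}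
    (hp : pᴴ = p) (hpp : p * p = p) (hpq : p + q = 1) (hX : Xᴴ = X) {s t : ℝ}
    (hst : s ^ 2 + t ^ 2 = 1) :
    hsNorm (X - (((s : ℂ) • p + (t : ℂ) • q) * X * ((s : ℂ) • p + (t : ℂ) • q) +
      ((t : ℂ) • p + (s : ℂ) • q) * X * ((t : ℂ) • p + (s : ℂ) • q))) ^ 2 =
      2 * (1 - 2 * s * t) ^ 2 * ((X * X * p).trace.re - (X * p * X * p).trace.re) := by
  obtain rfl : q = 1 - p := by rw [← hpq]; abel
  have hst' : (s : ℂ) ^ 2 + (t : ℂ) ^ 2 = 1 := by exact_mod_cast hst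
  -- The diagonal blocks carry `s² + t² = 1` and cancel; the off-diagonal ones carry `2st`.
  have hD : X - (((s : ℂ) • p + (t : ℂ) • (1 - p)) * X * ((s : ℂ) • p + (t : ℂ) • (1 - p)) +
      ((t : ℂ) • p + (s : ℂ) • (1 - p)) * X * ((t : ℂ) • p + (s : ℂ) • (1 - p))) =
      ((1 - 2 * s * t : ℝ) : ℂ) • (p * X * (1 - p) + (1 - p) * X * p) := by
    have h1 : (1 : ℂ) - 2 * s * t = ((s : ℂ) - t) ^ 2 := by linear_combination -hst'
    push_cast
    rw [h1]
    simp only [mul_sub, sub_mul, mul_add, add_mul, smul_mul_assoc, mul_smul_comm, mul_one, one_mul]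
    linear_combination (norm := module) -hst' • X
  set Z := p * X * (1 - p) + (1 - p) * X * p
  have hZ : Zᴴ = Z := by
    simp only [Z, Matrix.conjTranspose_add, Matrix.conjTranspose_mul, Matrix.conjTranspose_sub,
      Matrix.conjTranspose_one, hp, hX, Matrix.mul_assoc]
    abel
  have hppX : ∀ M : Matrix N N ℂ, p * (p * M) = p * M := fun M => by
    rw [← Matrix.mul_assoc, hpp]
  have htr : (Z * Z).trace = 2 * ((X * X * p).trace - (X * p * X * p).trace) := by
    have e1 : Z * Z = p * (X * X) * p - p * (X * p * X * p) + X * p * X - p * (X * p * X)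
        - X * p * X * p + p * (X * p * X * p) := by
      simp only [Z, mul_sub, sub_mul, mul_add, add_mul, mul_one, one_mul, Matrix.mul_assoc,
        hppX]
      abel
    have e2 : (p * (X * X) * p).trace = (X * X * p).trace := by
      rw [Matrix.trace_mul_comm, ← Matrix.mul_assoc, hpp, Matrix.trace_mul_comm]
    have e3 : (X * p * X).trace = (X * X * p).trace := by
      rw [Matrix.trace_mul_comm, ← Matrix.mul_assoc]
    have e4 : (p * (X * p * X)).trace = (X * p * X * p).trace := Matrix.trace_mul_comm _ _
    simp only [e1, Matrix.trace_add, Matrix.trace_sub, e2, e3, e4]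
    ring
  rw [hD, hsNorm_sq, Matrix.conjTranspose_smul, hZ, Matrix.smul_mul, Matrix.mul_smul, smul_smul,
    Matrix.trace_smul, htr, Complex.star_def, Complex.conj_ofReal, smul_eq_mul,
    ← Complex.ofReal_mul, Complex.re_ofReal_mul, Complex.mul_re]
  simp
  ring

namespace ProjectorPair

variable {m n : Type*} [Fintype m] [DecidableEq m] [Fintype n] [DecidableEq n]

theorem coherence_eq (P : ProjectorPair m) (x : ℝ) {σ : Matrix m m ℂ} (hσ : σ.PosSemidef) :
    P.coherence x σ = 2 * (1 - 2 * tauOne x * tauTwo x) ^ 2 *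
      ((σ * P.P₁).trace.re - (CFC.sqrt σ * P.P₁ * CFC.sqrt σ * P.P₁).trace.re) := by
  have hS := (Matrix.nonneg_iff_posSemidef.mp (CFC.sqrt_nonneg σ)).1
  rw [coherence, weakMap, weakPos, weakNeg, hsNorm_sub_weak_sq P.isStarProjection₁.2
    P.isStarProjection₁.1 P.sum_eq_one hS (tauOne_sq_add_tauTwo_sq x),
    CFC.sqrt_mul_sqrt_self σ (Matrix.nonneg_iff_posSemidef.mpr hσ)]

theorem coherenceAB_eq (P : ProjectorPair m) (x : ℝ) {ρ : Matrix (m × n) (m × n) ℂ}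
    (hρ : ρ.PosSemidef) :
    P.coherenceAB x ρ = 2 * (1 - 2 * tauOne x * tauTwo x) ^ 2 *
      ((ρ * (P.P₁ ⊗ₖ (1 : Matrix n n ℂ))).trace.re - (CFC.sqrt ρ * (P.P₁ ⊗ₖ (1 : Matrix n n ℂ)) *
        CFC.sqrt ρ * (P.P₁ ⊗ₖ (1 : Matrix n n ℂ))).trace.re) := by
  have hG := (Matrix.nonneg_iff_posSemidef.mp (CFC.sqrt_nonneg ρ)).1
  have h1 : (P.P₁ ⊗ₖ (1 : Matrix n n ℂ))ᴴ = P.P₁ ⊗ₖ (1 : Matrix n n ℂ) := by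
    rw [Matrix.conjTranspose_kronecker, Matrix.conjTranspose_one]
    exact congrArg (· ⊗ₖ _) P.isStarProjection₁.2
  have h2 : (P.P₁ ⊗ₖ (1 : Matrix n n ℂ)) * (P.P₁ ⊗ₖ (1 : Matrix n n ℂ)) =
      P.P₁ ⊗ₖ (1 : Matrix n n ℂ) := by
    rw [← Matrix.mul_kronecker_mul, Matrix.one_mul, P.isStarProjection₁.1.eq]
  have h3 : P.P₁ ⊗ₖ (1 : Matrix n n ℂ) + P.P₂ ⊗ₖ (1 : Matrix n n ℂ) = 1 := by
    rw [← Matrix.add_kronecker, P.sum_eq_one, Matrix.one_kronecker_one]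
  rw [coherenceAB, weakMapAB, weakPos, weakNeg]
  simp only [Matrix.add_kronecker, Matrix.smul_kronecker]
  rw [hsNorm_sub_weak_sq h1 h2 h3 hG (tauOne_sq_add_tauTwo_sq x),
    CFC.sqrt_mul_sqrt_self ρ (Matrix.nonneg_iff_posSemidef.mpr hρ)]

theorem deltaW_nonneg (P : ProjectorPair m) (x : ℝ) {ρ : Matrix (m × n) (m × n) ℂ}
    (hρ : ρ.PosSemidef) : 0 ≤ P.deltaW x ρ := by
  have hρa := posSemidef_marginalA hρ
  have h := re_trace_sandwich_kronecker_le
    (Matrix.nonneg_iff_posSemidef.mp (CFC.sqrt_nonneg ρ)).1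
    (CFC.sqrt_mul_sqrt_self ρ (Matrix.nonneg_iff_posSemidef.mpr hρ))
    (Matrix.nonneg_iff_posSemidef.mp (CFC.sqrt_nonneg (marginalA ρ)))
    (CFC.sqrt_mul_sqrt_self _ (Matrix.nonneg_iff_posSemidef.mpr hρa)) P.P₁
  have hP : P.P₁ᴴ = P.P₁ := P.isStarProjection₁.2
  rw [Matrix.conjTranspose_kronecker, Matrix.conjTranspose_one, hP] at h
  rw [deltaW, coherenceAB_eq P x hρ, coherence_eq P x hρa, trace_mul_kronecker_one, ← mul_sub]
  refine mul_nonneg (by positivity) ?_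
  linarith

/-- The coherence of the marginal need not be computed: once `C_H(ρ|Ω) = 0`, `Δ_w = -C_H(ρᵃ|Ω) ≤ 0`,
while `Δ_w ≥ 0` always. -/
theorem deltaW_eq_zero (P : ProjectorPair m) (x : ℝ) {ρ : Matrix (m × n) (m × n) ℂ}
    (hρ : ρ.PosSemidef) (h : P.projMapAB ρ = ρ) : P.deltaW x ρ = 0 := by
  set p := P.P₁ ⊗ₖ (1 : Matrix n n ℂ) with hp
  set q := P.P₂ ⊗ₖ (1 : Matrix n n ℂ) with hq
  have hpp : p * p = p := by
    rw [hp, ← Matrix.mul_kronecker_mul, Matrix.one_mul, P.isStarProjection₁.1.eq]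
  have hpq : p * q = 0 := by
    rw [hp, hq, ← Matrix.mul_kronecker_mul, P.orthogonal, Matrix.zero_kronecker]
  have hqp : q * p = 0 := by
    have : P.P₂ = 1 - P.P₁ := by rw [← P.sum_eq_one]; abel
    rw [hp, hq, ← Matrix.mul_kronecker_mul, this, Matrix.sub_mul, P.isStarProjection₁.1.eq]
    simp
  have hρpq : p * ρ * p + q * ρ * q = ρ := h
  have hcomm : Commute ρ p := by
    rw [Commute, SemiconjBy]
    conv_lhs => rw [← hρpq]
    conv_rhs => rw [← hρpq]
    simp only [Matrix.add_mul, Matrix.mul_add, Matrix.mul_assoc, hpp, hqp, Matrix.mul_zero]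
    simp only [← Matrix.mul_assoc, hpp, hpq, Matrix.zero_mul]
  have hsqrt : Commute (CFC.sqrt ρ) p := by
    rw [CFC.sqrt_eq_cfc]
    exact hcomm.cfc_nnreal _
  refine le_antisymm ?_ (P.deltaW_nonneg x hρ)
  have hAB : P.coherenceAB x ρ = 0 := by
    rw [coherenceAB_eq P x hρ, ← hp, Matrix.mul_assoc _ p, ← hsqrt.eq, ← Matrix.mul_assoc,
      Matrix.mul_assoc _ p, hpp, CFC.sqrt_mul_sqrt_self ρ (Matrix.nonneg_iff_posSemidef.mpr hρ),
      sub_self, mul_zero]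
  rw [deltaW, hAB, zero_sub, neg_nonpos]
  exact sq_nonneg _

/-! ### Attainment of the minimum -/

section Compactness

open scoped Matrix.Norms.L2Operator

/-- The first projectors of the projector pairs. -/
theorem range_P₁ : Set.range (fun P : ProjectorPair m => P.P₁) =
    {p | star p = p ∧ p * p = p ∧ ‖p‖ = 1 ∧ ‖1 - p‖ = 1} := by
  -- By the C⋆-identity a nonzero projection has norm one, which turns the open condition `p ≠ 0`
  -- into a closed one.
  have hnorm : ∀ p : Matrix m m ℂ, IsStarProjection p → p ≠ 0 → ‖p‖ = 1 := by
    intro p hp h0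
    have h1 := CStarRing.norm_star_mul_self (x := p)
    rw [hp.2.star_eq, hp.1.eq] at h1
    exact (mul_eq_left₀ (norm_ne_zero_iff.mpr h0)).mp h1.symm
  ext p
  constructor
  · rintro ⟨P, rfl⟩
    have : 1 - P.P₁ = P.P₂ := by rw [← P.sum_eq_one]; abel
    exact ⟨P.isStarProjection₁.2, P.isStarProjection₁.1, hnorm _ P.isStarProjection₁ P.ne_zero₁,
      this ▸ hnorm _ P.isStarProjection₂ P.ne_zero₂⟩
  · rintro ⟨h1, h2, h3, h4⟩
    have hp : IsStarProjection p := ⟨h2, h1⟩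
    refine ⟨⟨p, 1 - p, hp, hp.one_sub, ?_, by abel, ?_, ?_⟩, rfl⟩
    · rw [mul_sub, mul_one, h2, sub_self]
    · rintro rfl; simp at h3
    · intro h; simp [h] at h4

theorem isCompact_range_P₁ : IsCompact (Set.range fun P : ProjectorPair m => P.P₁) := by
  have : ProperSpace (Matrix m m ℂ) := FiniteDimensional.proper ℂ _
  rw [range_P₁]
  refine (isCompact_closedBall (0 : Matrix m m ℂ) 1).of_isClosed_subset ?_ fun p hp => ?_
  · refine (isClosed_eq continuous_star continuous_id).inter
      ((isClosed_eq (continuous_id.mul continuous_id) continuous_id).inter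
      ((isClosed_eq continuous_norm continuous_const).inter
      (isClosed_eq (continuous_const.sub continuous_id).norm continuous_const)))
  · rw [mem_closedBall_zero_iff]
    exact hp.2.2.1.le

end Compactness

theorem exists_continuous_deltaW (x : ℝ) {ρ : Matrix (m × n) (m × n) ℂ} (hρ : ρ.PosSemidef) :
    ∃ f : Matrix m m ℂ → ℝ, Continuous f ∧ ∀ P : ProjectorPair m, P.deltaW x ρ = f P.P₁ := by
  refine ⟨fun p => 2 * (1 - 2 * tauOne x * tauTwo x) ^ 2 *
    ((ρ * (p ⊗ₖ (1 : Matrix n n ℂ))).trace.re - (CFC.sqrt ρ * (p ⊗ₖ (1 : Matrix n n ℂ)) *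
      CFC.sqrt ρ * (p ⊗ₖ (1 : Matrix n n ℂ))).trace.re) -
    2 * (1 - 2 * tauOne x * tauTwo x) ^ 2 *
      ((marginalA ρ * p).trace.re -
        (CFC.sqrt (marginalA ρ) * p * CFC.sqrt (marginalA ρ) * p).trace.re), ?_, fun P => ?_⟩
  · have hk : Continuous fun p : Matrix m m ℂ => p ⊗ₖ (1 : Matrix n n ℂ) :=
      continuous_matrix fun i j => by
        simp only [Matrix.kroneckerMap_apply]
        fun_prop
    have hre : ∀ {ι : Type _} [Fintype ι] {g : Matrix m m ℂ → Matrix ι ι ℂ}, Continuous g →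
        Continuous fun p => (g p).trace.re := fun hg =>
      Complex.continuous_re.comp hg.matrix_trace
    have hk2 := hre (((continuous_const (y := CFC.sqrt ρ)).mul hk |>.mul
      (continuous_const (y := CFC.sqrt ρ))).mul hk)
    have hk1 := hre ((continuous_const (y := ρ)).mul hk)
    fun_prop
  · rw [deltaW, coherenceAB_eq P x hρ, coherence_eq P x (posSemidef_marginalA hρ)]

/-! ### From von Neumann measurements to projector pairs -/

theorem ketBra_mul_ketBra (e : OrthonormalBasis m ℂ (EuclideanSpace ℂ m)) (i j : m) :
    ketBra (e i) * ketBra (e j) = if i = j then ketBra (e i) else 0 := by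
  have h : (fun k => star (e i k)) ⬝ᵥ (fun k => e j k) = if i = j then (1 : ℂ) else 0 := by
    have := orthonormal_iff_ite.mp e.orthonormal i j
    rw [PiLp.inner_apply] at this
    rw [← this]
    exact Finset.sum_congr rfl fun k _ => mul_comm _ _
  rw [ketBra, ketBra, Matrix.vecMulVec_mul_vecMulVec, h]
  split_ifs with hij
  · subst hij; simp
  · simp

theorem ketBra_ne_zero {ι : Type*} {v : EuclideanSpace ℂ ι} (hv : v ≠ 0) : ketBra v ≠ 0 := by
  intro h
  apply hv
  ext i
  simpa [ketBra, Matrix.vecMulVec_apply] using congrFun (congrFun h i) i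

theorem isStarProjection_ketBra (e : OrthonormalBasis m ℂ (EuclideanSpace ℂ m)) (i : m) :
    IsStarProjection (ketBra (e i)) := by
  refine ⟨by rw [IsIdempotentElem, ketBra_mul_ketBra, if_pos rfl], ?_⟩
  ext j k
  simp [ketBra, Matrix.vecMulVec_apply, mul_comm]

theorem exists_P₁_eq_ketBra [Nontrivial m] (e : OrthonormalBasis m ℂ (EuclideanSpace ℂ m)) (i : m) :
    ∃ P : ProjectorPair m, P.P₁ = ketBra (e i) ∧ P.P₂ = 1 - ketBra (e i) := by
  have hp := isStarProjection_ketBra e i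
  refine ⟨⟨ketBra (e i), 1 - ketBra (e i), hp, hp.one_sub, ?_, by abel,
    ketBra_ne_zero (e.orthonormal.ne_zero i), fun h => ?_⟩, rfl, rfl⟩
  · rw [mul_sub, mul_one, hp.1.eq, sub_self]
  -- Here `d_a ≥ 2` enters: a second basis vector survives in the complement.
  · obtain ⟨j, hj⟩ := exists_ne i
    have := ketBra_mul_ketBra e i j
    rw [if_neg hj.symm, ← sub_eq_zero.mp h, one_mul] at this
    exact ketBra_ne_zero (e.orthonormal.ne_zero j) this

/-- Invariance survives coarse-graining the basis to `|i⟩⟨i|` and its complement, since `ρ` commutes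
with `|i⟩⟨i| ⊗ 1`. -/
theorem exists_of_isClassicallyCorrelated [Nontrivial m] {ρ : Matrix (m × n) (m × n) ℂ}
    (h : IsClassicallyCorrelated ρ) : ∃ P : ProjectorPair m, P.projMapAB ρ = ρ := by
  obtain ⟨e, he⟩ := h
  obtain ⟨i⟩ : Nonempty m := inferInstance
  obtain ⟨P, h1, h2⟩ := exists_P₁_eq_ketBra e i
  refine ⟨P, ?_⟩
  set E : m → Matrix (m × n) (m × n) ℂ := fun k => ketBra (e k) ⊗ₖ (1 : Matrix n n ℂ) with hE
  have hEE : ∀ k l, E k * E l = if k = l then E k else 0 := fun k l => by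
    simp only [hE]
    rw [← Matrix.mul_kronecker_mul, ketBra_mul_ketBra, Matrix.one_mul]
    split_ifs <;> simp
  have he' : ∑ k, E k * ρ * E k = ρ := he
  have hl : E i * ρ = E i * ρ * E i := by
    conv_lhs => rw [← he']
    rw [Finset.mul_sum, Finset.sum_eq_single i]
    · rw [← Matrix.mul_assoc, ← Matrix.mul_assoc, hEE, if_pos rfl]
    · intro k _ hk
      rw [← Matrix.mul_assoc, ← Matrix.mul_assoc, hEE, if_neg hk.symm, Matrix.zero_mul,
        Matrix.zero_mul]
    · simp
  have hr : ρ * E i = E i * ρ * E i := by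
    conv_lhs => rw [← he']
    rw [Finset.sum_mul, Finset.sum_eq_single i]
    · rw [Matrix.mul_assoc, hEE, if_pos rfl]
    · intro k _ hk
      rw [Matrix.mul_assoc, hEE, if_neg hk, Matrix.mul_zero]
    · simp
  have hq : (1 - ketBra (e i)) ⊗ₖ (1 : Matrix n n ℂ) = 1 - E i := by
    rw [hE, eq_sub_iff_add_eq, ← Matrix.add_kronecker, sub_add_cancel, Matrix.one_kronecker_one]
  rw [projMapAB, h1, h2, hq]
  change E i * ρ * E i + (1 - E i) * ρ * (1 - E i) = ρ
  simp only [mul_sub, sub_mul, mul_one, one_mul, hr, ← hl]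
  abel

end ProjectorPair

theorem mainTheorem8 {m n : Type*} [Fintype m] [DecidableEq m] [Nontrivial m]
    [Fintype n] [DecidableEq n] (x : ℝ) (ρ : Matrix (m × n) (m × n) ℂ)
    (hρ : IsDensityMatrix ρ) :
    IsLeast (Set.range fun P : ProjectorPair m => P.deltaW x ρ) (weakCorrelation x ρ) ∧
      0 ≤ weakCorrelation x ρ ∧
      (IsClassicallyCorrelated ρ → weakCorrelation x ρ = 0) ∧
      ((∃ P : ProjectorPair m, P.projMapAB ρ = ρ) → weakCorrelation x ρ = 0) := by
  -- Nonemptiness and boundedness below make the real `⨅` a genuine infimum rather than the default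
  -- `0`.
  have hne : Nonempty (ProjectorPair m) :=
    (ProjectorPair.exists_P₁_eq_ketBra (EuclideanSpace.basisFun m ℂ) 
      (Classical.arbitrary m)).nonempty
  have hbdd : BddBelow (Set.range fun P : ProjectorPair m => P.deltaW x ρ) :=
    ⟨0, by rintro _ ⟨P, rfl⟩; exact P.deltaW_nonneg x hρ.1⟩
  have h0 : 0 ≤ weakCorrelation x ρ := le_ciInf fun P => P.deltaW_nonneg x hρ.1
  have hproj : (∃ P : ProjectorPair m, P.projMapAB ρ = ρ) → weakCorrelation x ρ = 0 := by
    rintro ⟨P, hP⟩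
    exact le_antisymm ((ciInf_le hbdd P).trans_eq (P.deltaW_eq_zero x hρ.1 hP)) h0
  refine ⟨⟨?_, ?_⟩, h0, fun h => hproj (ProjectorPair.exists_of_isClassicallyCorrelated h), hproj⟩
  · obtain ⟨f, hf, hfP⟩ := ProjectorPair.exists_continuous_deltaW x hρ.1
    have hcomp : IsCompact (Set.range fun P : ProjectorPair m => P.deltaW x ρ) := by
      have := ProjectorPair.isCompact_range_P₁.image hf
      rw [← Set.range_comp] at this
      convert this using 2
      exact funext hfP
    exact hcomp.sInf_mem (Set.range_nonempty _)
  · rintro _ ⟨P, rfl⟩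
    exact ciInf_le hbdd P
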